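/- Let $q\ge 2$ be an integer and $n\ge 1$. A $q$-ary quantum code of length $n$ is a complex subspace $Q$ of the Hilbert space $(\mathbb{C}^q)^{\otimes n}$. The weight of an error operator $E=E_1\otimes\cdots\otimes E_n$ (with each $E_i$ a linear operator on $\mathbb{C}^q$) is the number of $i$ with $E_i\ne I$. The code $Q$ detects $E$ if there is $c\in\mathbb{C}$ with $\langle u,Ev\rangle=c\,\langle u,v\rangle$ for all $u,v\in Q$. A code $Q$ with $\dim_{\mathbb{C}} Q\geq 2$ has minimum distance $d$ if it detects every error of weight less than $d$ but fails to detect some error of weight $d$. A $q$-ary $[[n,k,d]]$ quantum code, with $k \ge 1$, is a $q$-ary quantum code of length $n$ with $\dim_{\mathbb{C}} Q=q^k$ and minimum distance $d$; it is a quantum MDS code if it attains the quantum Singleton bound, that is, $2d=n-k+2$. **Theorem.** Let $p$ be a prime and let $q=p^m$ with $m\ge 1$. Then for all integers $t,d$ with $1\le t\le q-1$, $2\le d\le t+2$ and $(p,t,d)\ne(2,q-1,q)$, there exists a $q$-ary $[[\,t(q+1)+2,\ t(q+1)-2d+4,\ d\,]]$ quantum MDS code. In particular (the case $t=q-1$),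 for every $2\le d\le q+1$, except $d=q$ when $q$ is even, there exists a $q$-ary $[[\,q^2+1,\ q^2+3-2d,\ d\,]]$ quantum MDS code. -/

import Mathlib

namespace QuantumCode

/-- The Hilbert space `(ℂ^q)^{⊗ n}` of `n` qudits of dimension `q`, in its standard orthonormal
basis: the product vectors `|x₁⟩ ⊗ ⋯ ⊗ |xₙ⟩` indexed by the words `x : Fin n → Fin q`. -/
abbrev QuditSpace (q n : ℕ) : Type := EuclideanSpace ℂ (Fin n → Fin q)

/-- The operator `M₁ ⊗ ⋯ ⊗ Mₙ` on `(ℂ^q)^{⊗ n}`. Its matrix in the product basis is the Kronecker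
product of the matrices `Mᵢ`. -/
noncomputable def tensorOp {q n : ℕ} (M : Fin n → Matrix (Fin q) (Fin q) ℂ) :
    QuditSpace q n →ₗ[ℂ] QuditSpace q n :=
  Matrix.toEuclideanLin (Matrix.of fun x y : Fin n → Fin q => ∏ i, M i (x i) (y i))

/-- The weight of the error `M₁ ⊗ ⋯ ⊗ Mₙ`: the number of qudits on which it does not act as the
identity. -/
noncomputable def weight {q n : ℕ} (M : Fin n → Matrix (Fin q) (Fin q) ℂ) : ℕ :=
  {i | M i ≠ 1}.ncard

/-- The code `Q` detects the error `E`: there is a scalar `c` with `⟨u, E v⟩ = c ⟨u, v⟩` for all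
`u, v` in `Q`, that is, `P E P = c P` for the orthogonal projection `P` onto `Q`. -/
def Detects {q n : ℕ} (Q : Submodule ℂ (QuditSpace q n))
    (E : QuditSpace q n →ₗ[ℂ] QuditSpace q n) : Prop :=
  ∃ c : ℂ, ∀ u ∈ Q, ∀ v ∈ Q, inner ℂ u (E v) = c * inner ℂ u v

/-- The code `Q` (of dimension at least two) has minimum distance exactly `d`: it detects every
error of weight less than `d`, and fails to detect some error of weight `d`.
(A code of dimension at most one detects every error, and no `d` satisfies this condition.) -/
def HasMinDist {q n : ℕ} (Q : Submodule ℂ (QuditSpace q n)) (d : ℕ) : Prop :=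
  (∀ M : Fin n → Matrix (Fin q) (Fin q) ℂ, weight M < d → Detects Q (tensorOp M)) ∧
    ∃ M : Fin n → Matrix (Fin q) (Fin q) ℂ, weight M = d ∧ ¬ Detects Q (tensorOp M)

/-- `Q` is a `q`-ary `[[n, k, d]]` quantum code: a subspace of `(ℂ^q)^{⊗ n}` of dimension `q ^ k`
and minimum distance `d`. -/
structure IsCode (q n k d : ℕ) (Q : Submodule ℂ (QuditSpace q n)) : Prop where
  finrank_eq : Module.finrank ℂ Q = q ^ k
  minDist : HasMinDist Q d

/-- `Q` is a `q`-ary `[[n, k, d]]` quantum MDS code: an `[[n, k, d]]` code that attains the quantum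
Singleton bound `2 d ≤ n - k + 2`. -/
structure IsMDSCode (q n k d : ℕ) (Q : Submodule ℂ (QuditSpace q n)) : Prop
    extends IsCode q n k d Q where
  singleton_eq : k + 2 * d = n + 2

end QuantumCode

/-!
A code with the required parameters is obtained from a classical code by the stabilizer
construction, in its Hermitian form.

Let `F` be the field with `q` elements, `K` its quadratic extension and `n` the length. The Weyl
operators on `n` qudits are labelled by `(F × F)^n`; they span all operators, and they commute up to
a character of the symplectic form. The operators of an isotropic subspace `S` have a common
eigenvector; the corresponding joint eigenspace has dimension `q ^ n / |S|`, detects every Weyl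
operator outside the symplectic complement of `S`, and fails to detect those in the complement but
not in `S` (`exists_isCode_of_isotropic`). Choosing a basis of `K` over `F` turns the symplectic form
into the antisymmetric part of the Hermitian form `∑ uᵢ vᵢ^q`, so that a Hermitian self-orthogonal
code in `K^n` gives such an `S` (`exists_isCode_of_hermitian`).

The classical code is a generalized Reed–Solomon code of dimension `d - 1`, which evaluates
polynomials of degree at most `r = d - 2` at `t (q + 1) + 1` points of `K` and at infinity. After
rescaling, self-orthogonality asks for nonzero weights `w(x)` in `F` with
`∑ w(x) x ^ (a + q b) = 0` for `a, b ≤ r`, except for a nonzero value at `a = b = r`, which the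
point at infinity compensates (`exists_isCode_of_weights`). The distances are those of MDS codes.

* If `w(x)` depends on the norm `N(x)` only and the points are those with norm in a set `A` of
  `t + 1` elements of `F` that contains `0`, then the conditions with `a ≠ b` are automatic, and the
  others say that the weights on `A` annihilate the powers below `r`, but not the power `r`.
  Lagrange weights times the values of a polynomial of degree `t - r` without zeros on `A` have
  this property. The polynomial exists unless `t - r = 1` and `A` is the whole field.
* In that last case, `t = q - 1` and `d = q`, the characteristic is odd by hypothesis, and
  `w(x) = Tr(x) ^ 2 - η` works on the whole of `K`, for a nonsquare `η` of `F`.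
-/

/-! ### Common eigenvectors -/

/-- A family of pairwise commuting endomorphisms of a nonzero finite-dimensional complex vector
space has a common eigenvector: all of them act as scalars on a minimal nonzero invariant
subspace. -/
theorem exists_common_eigenvector {V ι : Type*} [AddCommGroup V] [Module ℂ V]
    [FiniteDimensional ℂ V] [Nontrivial V] (f : ι → Module.End ℂ V)
    (h : ∀ i j, f i * f j = f j * f i) :
    ∃ (v : V) (χ : ι → ℂ), v ≠ 0 ∧ ∀ i, f i v = χ i • v := by
  obtain ⟨U, ⟨hU0, hUi⟩, hmin⟩ := wellFounded_lt.has_min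
    {U : Submodule ℂ V | U ≠ ⊥ ∧ ∀ i, ∀ x ∈ U, f i x ∈ U} ⟨⊤, top_ne_bot, by simp⟩
  have key : ∀ i, ∃ c : ℂ, ∀ x ∈ U, f i x = c • x := by
    intro i
    have : Nontrivial U := (Submodule.nontrivial_iff_ne_bot).2 hU0
    obtain ⟨c, hc⟩ := Module.End.exists_eigenvalue ((f i).restrict (hUi i))
    obtain ⟨w, hw⟩ := hc.exists_hasEigenvector
    have hw1 : f i w = c • (w : V) := congrArg Subtype.val hw.apply_eq_smul
    have hw0 : (w : V) ≠ 0 := fun h0 => hw.2 (Subtype.ext h0)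
    refine ⟨c, fun x hx => ?_⟩
    by_contra hne
    refine hmin (U ⊓ Module.End.eigenspace (f i) c) ⟨?_, fun j y hy => ?_⟩ ?_
    · refine (Submodule.ne_bot_iff _).2 ⟨w, ⟨w.2, ?_⟩, hw0⟩
      exact Module.End.mem_eigenspace_iff.2 hw1
    · refine ⟨hUi j y hy.1, Module.End.mem_eigenspace_iff.2 ?_⟩
      rw [← Module.End.mul_apply, h i j, Module.End.mul_apply,
        Module.End.mem_eigenspace_iff.1 hy.2, map_smul]
    · refine lt_of_le_of_ne inf_le_left fun he => hne ?_
      rw [← he] at hx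
      exact Module.End.mem_eigenspace_iff.1 hx.2
  choose χ hχ using key
  obtain ⟨v, hv, hv0⟩ := (Submodule.ne_bot_iff U).1 hU0
  exact ⟨v, χ, hv0, fun i => hχ i v hv⟩

namespace QuantumCode

/-! ### Tensor products of operators -/

section TensorOp

variable {q n : ℕ}

theorem tensorOp_mul (M N : Fin n → Matrix (Fin q) (Fin q) ℂ) :
    tensorOp M * tensorOp N = tensorOp fun i => M i * N i := by
  unfold tensorOp
  rw [Module.End.mul_eq_comp]
  refine (Matrix.toLpLin_mul_same 2 _ _).symm.trans (congrArg _ ?_)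
  ext x z
  simp only [Matrix.mul_apply, Matrix.of_apply, ← Finset.prod_mul_distrib, Finset.prod_univ_sum,
    Fintype.piFinset_univ]

theorem tensorOp_smul (c : Fin n → ℂ) (M : Fin n → Matrix (Fin q) (Fin q) ℂ) :
    tensorOp (fun i => c i • M i) = (∏ i, c i) • tensorOp M := by
  unfold tensorOp
  rw [← map_smul]
  congr 1
  ext x z
  simp [Finset.prod_mul_distrib]

theorem tensorOp_one : tensorOp (fun _ : Fin n => (1 : Matrix (Fin q) (Fin q) ℂ)) = 1 := by
  unfold tensorOp
  refine (congrArg _ ?_).trans (Matrix.toLpLin_one 2)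
  ext x z
  simp only [Matrix.of_apply, Matrix.one_apply, Finset.prod_ite_zero, Finset.prod_const_one,
    Finset.mem_univ, true_implies, funext_iff]

/-- Multilinearity: a tensor product of sums expands into the sum of all tensor products. -/
theorem tensorOp_sum {κ : Type*} [Fintype κ] (c : Fin n → κ → ℂ)
    (M : κ → Matrix (Fin q) (Fin q) ℂ) :
    tensorOp (fun i => ∑ v, c i v • M v) =
      ∑ v : Fin n → κ, (∏ i, c i (v i)) • tensorOp fun i => M (v i) := by
  classical
  simp_rw [← tensorOp_smul]
  unfold tensorOp
  rw [← map_sum]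
  congr 1
  ext x z
  simp only [Matrix.of_apply, Matrix.sum_apply, Finset.prod_univ_sum, Fintype.piFinset_univ]

theorem trace_tensorOp (M : Fin n → Matrix (Fin q) (Fin q) ℂ) :
    LinearMap.trace ℂ _ (tensorOp M) = ∏ i, (M i).trace := by
  unfold tensorOp
  rw [Matrix.toEuclideanLin, Matrix.toLpLin_eq_toLin, Matrix.trace_toLin_eq]
  simp only [Matrix.trace, Matrix.diag, Matrix.of_apply, Finset.prod_univ_sum,
    Fintype.piFinset_univ]

/-- A tensor product of isometries is an isometry. -/
theorem inner_tensorOp_tensorOp {M : Fin n → Matrix (Fin q) (Fin q) ℂ}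
    (hM : ∀ i, (M i).conjTranspose * M i = 1) (u v : QuditSpace q n) :
    inner ℂ (tensorOp M u) (tensorOp M v) = inner ℂ u v := by
  have hadj : LinearMap.adjoint (tensorOp M) = tensorOp fun i => (M i).conjTranspose := by
    unfold tensorOp
    rw [← Matrix.toEuclideanLin_conjTranspose_eq_adjoint]
    congr 1
    ext x z
    simp [Matrix.conjTranspose_apply]
  rw [← LinearMap.adjoint_inner_right, hadj, ← Module.End.mul_apply, tensorOp_mul]
  simp only [hM, tensorOp_one, Module.End.one_apply]

end TensorOp

/-! ### Detection is a linear condition -/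

section Detects

variable {q n : ℕ} {Q : Submodule ℂ (QuditSpace q n)}

theorem detects_one : Detects Q 1 := ⟨1, by simp⟩

theorem detects_zero : Detects Q 0 := ⟨0, by simp⟩

theorem Detects.smul {E : QuditSpace q n →ₗ[ℂ] QuditSpace q n} (h : Detects Q E) (a : ℂ) :
    Detects Q (a • E) := by
  obtain ⟨c, hc⟩ := h
  exact ⟨a * c, fun u hu v hv => by
    rw [LinearMap.smul_apply, inner_smul_right, hc u hu v hv, mul_assoc]⟩

theorem detects_sum {κ : Type*} (s : Finset κ) (E : κ → QuditSpace q n →ₗ[ℂ] QuditSpace q n)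
    (h : ∀ i ∈ s, Detects Q (E i)) : Detects Q (∑ i ∈ s, E i) := by
  choose! c hc using h
  refine ⟨∑ i ∈ s, c i, fun u hu v hv => ?_⟩
  rw [LinearMap.sum_apply, inner_sum, Finset.sum_mul]
  exact Finset.sum_congr rfl fun i hi => hc i hi u hu v hv

end Detects

/-! ### Weyl matrices -/

section Weyl

variable {q : ℕ} {F : Type*} [Field F] [DecidableEq F]
  (e : Fin q ≃ F) (ψ : AddChar F ℂ)

/-- The Weyl (generalized Pauli) matrix `X(a) Z(b)` of `v = (a, b)`, sending `|y⟩` to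
`ψ(b y) |y + a⟩`. The basis of `ℂ^q` is labelled by the field `F` through `e`. -/
noncomputable def weyl (v : F × F) : Matrix (Fin q) (Fin q) ℂ :=
  Matrix.of fun x y => if e x = e y + v.1 then ψ (v.2 * e y) else 0

theorem weyl_mul (v w : F × F) :
    weyl e ψ v * weyl e ψ w = ψ (v.2 * w.1) • weyl e ψ (v + w) := by
  ext x z
  simp only [weyl, Matrix.mul_apply, Matrix.of_apply, Matrix.smul_apply, smul_eq_mul, Prod.fst_add,
    Prod.snd_add]
  rw [Finset.sum_eq_single (e.symm (e z + w.1))]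
  · simp only [Equiv.apply_symm_apply, if_true]
    by_cases h : e x = e z + w.1 + v.1
    · rw [if_pos h, if_pos (by rw [h]; ring), ← AddChar.map_add_eq_mul, ← AddChar.map_add_eq_mul]
      congr 1; ring
    · rw [if_neg h, if_neg (fun h' => h (by rw [h']; ring))]; simp
  · intro y _ hy
    rw [if_neg (c := e y = e z + w.1) (fun h' => hy (by rw [← h', Equiv.symm_apply_apply])),
      mul_zero]
  · simp

theorem weyl_zero : weyl e ψ 0 = 1 := by
  ext x y
  simp [weyl, Matrix.one_apply]

variable [Fintype F]

theorem conjTranspose_weyl_mul_weyl (v : F × F) :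
    (weyl e ψ v).conjTranspose * weyl e ψ v = 1 := by
  ext x z
  simp only [weyl, Matrix.mul_apply, Matrix.of_apply, Matrix.conjTranspose_apply, Matrix.one_apply]
  rw [Finset.sum_eq_single (e.symm (e x + v.1))]
  · simp only [Equiv.apply_symm_apply, if_true, add_left_inj, e.injective.eq_iff]
    split_ifs with h
    · subst h
      rw [RCLike.star_def, ← AddChar.map_neg_eq_conj, ← AddChar.map_add_eq_mul]
      simp
    · simp
  · intro y _ hy
    rw [if_neg (c := e y = e x + v.1) (fun h' => hy (by rw [← h', Equiv.symm_apply_apply]))]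
    simp
  · simp

variable {ψ}

theorem trace_weyl (hψ : ψ.IsPrimitive) (v : F × F) :
    (weyl e ψ v).trace = if v = 0 then (q : ℂ) else 0 := by
  have hq : Fintype.card F = q := by rw [← Fintype.card_congr e, Fintype.card_fin]
  have h1 := AddChar.sum_mulShift v.2 hψ
  obtain ⟨a, b⟩ := v
  simp only [weyl, Matrix.trace, Matrix.diag, Matrix.of_apply, left_eq_add, Prod.mk_eq_zero]
  by_cases ha : a = 0
  · simp only [ha, if_true, true_and]
    rw [Equiv.sum_comp e fun y => ψ (b * y)]
    simp_rw [mul_comm b]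
    rw [h1, hq]; simp
  · simp [ha]

theorem weyl_eq_one_iff (hψ : ψ.IsPrimitive) (v : F × F) : weyl e ψ v = 1 ↔ v = 0 := by
  refine ⟨fun h => ?_, fun h => h ▸ weyl_zero e ψ⟩
  by_contra hv
  have h1 := trace_weyl e hψ v
  rw [h, if_neg hv, Matrix.trace_one, Fintype.card_congr e] at h1
  exact Fintype.card_ne_zero (Nat.cast_eq_zero.1 h1)

/-- The Weyl matrices span all matrices (by Fourier inversion along each diagonal). -/
theorem exists_eq_sum_weyl (hψ : ψ.IsPrimitive) (M : Matrix (Fin q) (Fin q) ℂ) :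
    ∃ c : F × F → ℂ, M = ∑ v, c v • weyl e ψ v := by
  have hq0 : (Fintype.card F : ℂ) ≠ 0 := Nat.cast_ne_zero.2 Fintype.card_ne_zero
  refine ⟨fun v => (Fintype.card F : ℂ)⁻¹ *
    ∑ y : F, M (e.symm (y + v.1)) (e.symm y) * ψ (-(v.2 * y)), ?_⟩
  ext x z
  simp only [Matrix.sum_apply, Matrix.smul_apply, weyl, Matrix.of_apply, smul_eq_mul,
    Fintype.sum_prod_type]
  rw [Finset.sum_eq_single (e x - e z)]
  · simp only [add_sub_cancel, if_true, mul_assoc, Finset.sum_mul, ← Finset.mul_sum,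
      ← AddChar.map_add_eq_mul]
    rw [Finset.sum_comm]
    have h1 : ∀ y : F, ∑ b : F, M (e.symm (y + (e x - e z))) (e.symm y) *
        ψ (-(b * y) + b * e z) = if y = e z then M x z * Fintype.card F else 0 := by
      intro y
      have h2 := AddChar.sum_mulShift (e z - y) hψ
      rw [← Finset.mul_sum]
      have h3 : ∀ b : F, -(b * y) + b * e z = b * (e z - y) := fun b => by ring
      simp_rw [h3]
      rw [h2]
      by_cases hy : y = e z
      · simp [hy]
      · rw [if_neg (sub_ne_zero.2 (Ne.symm hy)), if_neg hy]; simp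
    simp_rw [h1]
    rw [Finset.sum_ite_eq' Finset.univ (e z), if_pos (Finset.mem_univ _)]
    field_simp
  · intro a _ ha
    refine Finset.sum_eq_zero fun b _ => ?_
    rw [if_neg (fun h => ha (by rw [h]; ring)), mul_zero]
  · simp

end Weyl

theorem addChar_map_sum {A ι : Type*} [AddCommMonoid A] (ψ : AddChar A ℂ) (s : Finset ι)
    (f : ι → A) :
    ψ (∑ i ∈ s, f i) = ∏ i ∈ s, ψ (f i) := by
  classical
  induction s using Finset.induction_on with
  | empty => simp
  | insert a s ha ih => rw [Finset.sum_insert ha, Finset.prod_insert ha, ψ.map_add_eq_mul, ih]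

/-! ### Stabilizer codes -/

section Stabilizer

variable {q n : ℕ} {F : Type*} [Field F]

/-- The symplectic form `∑ᵢ (aᵢ b'ᵢ - bᵢ a'ᵢ)` of `u = (aᵢ, bᵢ)ᵢ` and `v = (a'ᵢ, b'ᵢ)ᵢ`. It measures
the failure of the Weyl operators of `u` and `v` to commute. -/
def sympForm (u v : Fin n → F × F) : F := ∑ i, ((u i).1 * (v i).2 - (u i).2 * (v i).1)

theorem sympForm_smul_left (c : F) (u v : Fin n → F × F) :
    sympForm (c • u) v = c * sympForm u v := by
  simp only [sympForm, Finset.mul_sum, Pi.smul_apply, Prod.smul_fst, Prod.smul_snd, smul_eq_mul]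
  exact Finset.sum_congr rfl fun i _ => by ring

variable [DecidableEq F] (e : Fin q ≃ F) (ψ : AddChar F ℂ)

/-- The Weyl operator of `v` on `n` qudits: the tensor product of the Weyl matrices of the `vᵢ`. -/
noncomputable def weylOp (v : Fin n → F × F) : Module.End ℂ (QuditSpace q n) :=
  tensorOp fun i => weyl e ψ (v i)

theorem weylOp_mul (v w : Fin n → F × F) :
    weylOp e ψ v * weylOp e ψ w = ψ (∑ i, (v i).2 * (w i).1) • weylOp e ψ (v + w) := by
  unfold weylOp
  rw [tensorOp_mul, addChar_map_sum, ← tensorOp_smul]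
  simp only [weyl_mul, Pi.add_apply]

theorem weylOp_zero : weylOp e ψ (0 : Fin n → F × F) = 1 := by
  simp only [weylOp, Pi.zero_apply, weyl_zero, tensorOp_one]

theorem weylOp_mul_comm (v w : Fin n → F × F) :
    weylOp e ψ v * weylOp e ψ w = ψ (-sympForm v w) • (weylOp e ψ w * weylOp e ψ v) := by
  rw [weylOp_mul, weylOp_mul, smul_smul, ← AddChar.map_add_eq_mul, add_comm w v]
  congr 2
  rw [sympForm, ← Finset.sum_neg_distrib, ← Finset.sum_add_distrib]
  exact Finset.sum_congr rfl fun i _ => by ring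

/-- The stabilizer code of `S` with eigenvalues `χ`: the joint eigenspace of the Weyl operators of
the elements of `S`. -/
noncomputable def stabilizerCode (S : Submodule F (Fin n → F × F)) (χ : S → ℂ) :
    Submodule ℂ (QuditSpace q n) :=
  ⨅ s : S, LinearMap.eqLocus (weylOp e ψ (s : Fin n → F × F)) (χ s • LinearMap.id)

theorem mem_stabilizerCode {ψ : AddChar F ℂ} {S : Submodule F (Fin n → F × F)} {χ : S → ℂ}
    {x : QuditSpace q n} :
    x ∈ stabilizerCode e ψ S χ ↔ ∀ s : S, weylOp e ψ (s : Fin n → F × F) x = χ s • x := by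
  simp [stabilizerCode, Submodule.mem_iInf]

variable {ψ}

/-- The eigenvalues of a joint eigenvector are compatible with the multiplication of Weyl
operators, that is, they trivialize the cocycle. -/
theorem eigenvalue_mul {S : Submodule F (Fin n → F × F)} {χ : S → ℂ} {x : QuditSpace q n}
    (hx0 : x ≠ 0) (hx : x ∈ stabilizerCode e ψ S χ) (s t : S) :
    χ s * χ t = ψ (∑ i, ((s : Fin n → F × F) i).2 * ((t : Fin n → F × F) i).1) * χ (s + t) := by
  rw [mem_stabilizerCode] at hx
  have h1 := congrArg (fun f => f x) (weylOp_mul e ψ (s : Fin n → F × F) t)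
  simp only [Module.End.mul_apply, LinearMap.smul_apply, hx t, map_smul, hx s] at h1
  have h2 := hx (s + t)
  rw [Submodule.coe_add] at h2
  rw [h2, smul_smul, smul_smul] at h1
  rw [mul_comm]
  exact smul_left_injective _ hx0 h1

theorem eigenvalue_zero {S : Submodule F (Fin n → F × F)} {χ : S → ℂ} {x : QuditSpace q n}
    (hx0 : x ≠ 0) (hx : x ∈ stabilizerCode e ψ S χ) : χ 0 = 1 := by
  have h1 := (mem_stabilizerCode e).1 hx 0
  rw [Submodule.coe_zero, weylOp_zero, Module.End.one_apply] at h1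
  exact (smul_left_injective _ hx0 (by simpa using h1)).symm

theorem eigenvalue_ne_zero {S : Submodule F (Fin n → F × F)} {χ : S → ℂ} {x : QuditSpace q n}
    (hx0 : x ≠ 0) (hx : x ∈ stabilizerCode e ψ S χ) (s : S) : χ s ≠ 0 := by
  intro h0
  have h1 := eigenvalue_mul e hx0 hx s (-s)
  rw [h0, zero_mul, add_neg_cancel, eigenvalue_zero e hx0 hx, mul_one] at h1
  exact (AddChar.val_isUnit ψ _).ne_zero h1.symm

variable (ψ) [Fintype F]

theorem inner_weylOp_weylOp (s : Fin n → F × F) (u v : QuditSpace q n) :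
    inner ℂ (weylOp e ψ s u) (weylOp e ψ s v) = inner ℂ u v :=
  inner_tensorOp_tensorOp (fun i => conjTranspose_weyl_mul_weyl e ψ (s i)) u v

variable {ψ}

theorem trace_weylOp (hψ : ψ.IsPrimitive) (v : Fin n → F × F) :
    LinearMap.trace ℂ _ (weylOp e ψ v) = if v = 0 then (q : ℂ) ^ n else 0 := by
  unfold weylOp
  rw [trace_tensorOp]
  simp only [trace_weyl e hψ, Finset.prod_ite_zero, Finset.mem_univ, true_implies, funext_iff,
    Pi.zero_apply, Finset.prod_const, Finset.card_univ, Fintype.card_fin]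

theorem weight_weyl (hψ : ψ.IsPrimitive) (v : Fin n → F × F) :
    weight (fun i => weyl e ψ (v i)) = {i | v i ≠ 0}.ncard := by
  simp only [weight, ne_eq, weyl_eq_one_iff e hψ]

/-- Every error is a combination of Weyl operators supported where it acts nontrivially, so it is
detected as soon as those are. -/
theorem detects_tensorOp (hψ : ψ.IsPrimitive) {Q : Submodule ℂ (QuditSpace q n)} {d : ℕ}
    (hQ : ∀ v : Fin n → F × F, {i | v i ≠ 0}.ncard < d → Detects Q (weylOp e ψ v))
    (M : Fin n → Matrix (Fin q) (Fin q) ℂ) (hM : weight M < d) : Detects Q (tensorOp M) := by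
  have hc : ∀ i, ∃ c : F × F → ℂ, M i = ∑ v, c v • weyl e ψ v ∧ (M i = 1 → ∀ v ≠ 0, c v = 0) := by
    intro i
    by_cases h : M i = 1
    · refine ⟨Pi.single 0 1, ?_, fun _ v hv => Pi.single_eq_of_ne hv _⟩
      rw [Finset.sum_eq_single 0 (fun v _ hv => by rw [Pi.single_eq_of_ne hv, zero_smul])
        (by simp), Pi.single_eq_same, one_smul, weyl_zero, h]
    · obtain ⟨c, hc⟩ := exists_eq_sum_weyl e hψ (M i)
      exact ⟨c, hc, fun h' => absurd h' h⟩
  choose c hc hc1 using hc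
  have : tensorOp M = ∑ v : Fin n → F × F, (∏ i, c i (v i)) • weylOp e ψ v := by
    rw [funext hc, tensorOp_sum]; rfl
  rw [this]
  refine detects_sum _ _ fun v _ => ?_
  by_cases hv : ∏ i, c i (v i) = 0
  · rw [hv, zero_smul]; exact detects_zero
  · refine (hQ v ((Set.ncard_le_ncard ?_).trans_lt hM)).smul _
    intro i hi h1
    exact hv (Finset.prod_eq_zero (Finset.mem_univ i) (hc1 i h1 _ hi))

variable (ψ) in
/-- The average of the normalized Weyl operators `(χ s)⁻¹ W(s)` over the stabilizer. -/
noncomputable def stabilizerProj (S : Submodule F (Fin n → F × F)) (χ : S → ℂ) :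
    Module.End ℂ (QuditSpace q n) :=
  letI := Fintype.ofFinite S
  (Nat.card S : ℂ)⁻¹ • ∑ s : S, (χ s)⁻¹ • weylOp e ψ (s : Fin n → F × F)

theorem isProj_stabilizerProj {S : Submodule F (Fin n → F × F)}
    {χ : S → ℂ} {x : QuditSpace q n} (hx0 : x ≠ 0) (hx : x ∈ stabilizerCode e ψ S χ) :
    LinearMap.IsProj (stabilizerCode e ψ S χ) (stabilizerProj e ψ S χ) := by
  let := Fintype.ofFinite S
  have hS0 : (Nat.card S : ℂ) ≠ 0 := Nat.cast_ne_zero.2 Nat.card_pos.ne'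
  have hmul := eigenvalue_mul e hx0 hx
  have hne := eigenvalue_ne_zero e hx0 hx
  refine ⟨fun y => (mem_stabilizerCode e).2 fun t => ?_, fun y hy => ?_⟩
  · have h1 : weylOp e ψ (t : Fin n → F × F) * stabilizerProj e ψ S χ =
        χ t • stabilizerProj e ψ S χ := by
      simp only [stabilizerProj, mul_smul_comm, Finset.mul_sum]
      rw [smul_comm (χ t) (Nat.card S : ℂ)⁻¹]
      congr 1
      rw [Finset.smul_sum, ← Equiv.sum_comp (Equiv.addLeft t)
        (fun s : S => χ t • (χ s)⁻¹ • weylOp e ψ (s : Fin n → F × F))]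
      refine Finset.sum_congr rfl fun s _ => ?_
      rw [weylOp_mul, smul_smul, smul_smul, Equiv.coe_addLeft, Submodule.coe_add]
      congr 1
      have := hmul t s
      have h1 := hne s
      have h2 := hne (t + s)
      field_simp
      rw [mul_comm (χ s), this]
    exact congrArg (fun f => f y) h1
  · simp only [stabilizerProj, LinearMap.smul_apply, LinearMap.sum_apply,
      (mem_stabilizerCode e).1 hy, smul_smul, inv_mul_cancel₀ (hne _), one_smul, Finset.sum_const,
      Finset.card_univ, ← Nat.card_eq_fintype_card]
    rw [← Nat.cast_smul_eq_nsmul ℂ, smul_smul, inv_mul_cancel₀ hS0, one_smul]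

/-- The dimension of a nonzero stabilizer code is the trace of the averaging projection onto it, in
which only the identity has nonzero trace. -/
theorem finrank_stabilizerCode_mul (hψ : ψ.IsPrimitive) {S : Submodule F (Fin n → F × F)}
    {χ : S → ℂ} {x : QuditSpace q n} (hx0 : x ≠ 0) (hx : x ∈ stabilizerCode e ψ S χ) :
    Module.finrank ℂ (stabilizerCode e ψ S χ) * Nat.card S = q ^ n := by
  have hS0 : (Nat.card S : ℂ) ≠ 0 := Nat.cast_ne_zero.2 Nat.card_pos.ne'
  have htr := (isProj_stabilizerProj e hx0 hx).trace
  have htr' : LinearMap.trace ℂ _ (stabilizerProj e ψ S χ) =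
      (Nat.card S : ℂ)⁻¹ * (q : ℂ) ^ n := by
    simp only [stabilizerProj, map_smul, map_sum, trace_weylOp e hψ, smul_eq_mul]
    rw [Finset.sum_eq_single 0]
    · simp [eigenvalue_zero e hx0 hx]
    · intro s _ hs
      rw [if_neg (fun h : (s : Fin n → F × F) = 0 => hs (Subtype.ext h)), mul_zero]
    · simp
  rw [htr'] at htr
  have : ((Module.finrank ℂ (stabilizerCode e ψ S χ) * Nat.card S : ℕ) : ℂ) = (q ^ n : ℕ) := by
    push_cast
    rw [← htr]
    field_simp
  exact_mod_cast this

theorem trace_weylOp_mul_stabilizerProj (hψ : ψ.IsPrimitive) {S : Submodule F (Fin n → F × F)}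
    (χ : S → ℂ) {v : Fin n → F × F} (hv : v ∉ S) :
    LinearMap.trace ℂ _ (weylOp e ψ v * stabilizerProj e ψ S χ) = 0 := by
  simp only [stabilizerProj, mul_smul_comm, Finset.mul_sum, map_smul, map_sum, weylOp_mul,
    trace_weylOp e hψ, smul_eq_mul]
  refine Finset.sum_eq_zero fun s _ => ?_
  have hvs : v + s ≠ 0 := fun h => hv (by
    rw [eq_neg_of_add_eq_zero_left h]; exact S.neg_mem s.2)
  simp only [if_neg hvs, mul_zero]

end Stabilizer

/-- **Stabilizer codes.** An isotropic `F`-subspace `S` whose symplectic complement has minimum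
weight at least `d`, with weight `d` attained outside `S`, yields a quantum code. -/
theorem exists_isCode_of_isotropic {q n : ℕ} {F : Type*} [Field F] [Fintype F]
    (hF : Fintype.card F = q) {k d : ℕ}
    (S : Submodule F (Fin n → F × F)) (hS : ∀ u ∈ S, ∀ v ∈ S, sympForm u v = 0)
    (hd : ∀ v : Fin n → F × F, (∀ s ∈ S, sympForm s v = 0) → v ≠ 0 → d ≤ {i | v i ≠ 0}.ncard)
    (hex : ∃ v ∉ S, (∀ s ∈ S, sympForm s v = 0) ∧ {i | v i ≠ 0}.ncard = d)
    (hk : Module.finrank F S + k = n) :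
    ∃ Q : Submodule ℂ (QuditSpace q n), IsCode q n k d Q := by
  classical
  have e : Fin q ≃ F := (Fintype.equivFinOfCardEq hF).symm
  have hq0 : 0 < q := hF ▸ Fintype.card_pos
  obtain ⟨ψ, hψ⟩ : ∃ ψ : AddChar F ℂ, ψ.IsPrimitive :=
    ⟨_, AddChar.FiniteField.primitiveChar_to_Complex_isPrimitive F⟩
  have : Nonempty (Fin q) := ⟨⟨0, hq0⟩⟩
  obtain ⟨x, χ, hx0, hx⟩ := exists_common_eigenvector
    (fun s : S => weylOp e ψ (s : Fin n → F × F)) fun s t => by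
      rw [weylOp_mul_comm, hS s s.2 t t.2, neg_zero, AddChar.map_zero_eq_one, one_smul]
  have hxQ : x ∈ stabilizerCode e ψ S χ := (mem_stabilizerCode e).2 hx
  have hmem := fun y => mem_stabilizerCode (x := y) e (ψ := ψ) (S := S) (χ := χ)
  have hdim := finrank_stabilizerCode_mul e hψ hx0 hxQ
  have hne := eigenvalue_ne_zero e hx0 hxQ
  refine ⟨stabilizerCode e ψ S χ, ?_, detects_tensorOp e hψ fun v hv => ?_, ?_⟩
  · have hcS : Nat.card S = q ^ Module.finrank F S := by
      rw [Module.natCard_eq_pow_finrank (K := F), Nat.card_eq_fintype_card, hF]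
    refine Nat.eq_of_mul_eq_mul_right (Nat.pow_pos hq0 : 0 < q ^ Module.finrank F S) ?_
    rw [← hcS, hdim, hcS, ← pow_add, add_comm k, hk]
  · by_cases hv0 : v = 0
    · rw [hv0, weylOp_zero]; exact detects_one
    -- An error that fails to commute with some stabilizer maps the code to its orthogonal.
    · obtain ⟨s, hs, hsv⟩ : ∃ s ∈ S, sympForm s v ≠ 0 := by
        by_contra! h
        exact absurd (hd v h hv0) (not_le.2 hv)
      obtain ⟨c, hc⟩ := AddChar.ne_one_iff.1 (hψ (neg_ne_zero.2 hsv))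
      rw [AddChar.mulShift_apply] at hc
      have hcs : c • s ∈ S := S.smul_mem c hs
      refine ⟨0, fun u hu w hw => ?_⟩
      rw [zero_mul]
      have hu' := (hmem u).1 hu ⟨_, hcs⟩
      have hw' := (hmem w).1 hw ⟨_, hcs⟩
      simp only at hu' hw'
      set z : ℂ := χ ⟨c • s, hcs⟩
      have hz : (starRingEnd ℂ) z * z = 1 := by
        have h1 := inner_weylOp_weylOp e ψ (c • s) x x
        rw [show weylOp e ψ (c • s) x = z • x from hx ⟨_, hcs⟩, inner_smul_left,
          inner_smul_right, ← mul_assoc] at h1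
        exact mul_right_cancel₀ (inner_self_ne_zero.2 hx0) (h1.trans (one_mul _).symm)
      have h1 := inner_weylOp_weylOp e ψ (c • s) u (weylOp e ψ v w)
      rw [← Module.End.mul_apply, weylOp_mul_comm, LinearMap.smul_apply, Module.End.mul_apply, hu',
        hw', map_smul, inner_smul_left, inner_smul_right, inner_smul_right, sympForm_smul_left] at h1
      have h2 : (ψ (-(c * sympForm s v)) - 1) * inner ℂ u (weylOp e ψ v w) = 0 := by
        linear_combination h1 - ψ (-(c * sympForm s v)) * inner ℂ u (weylOp e ψ v w) * hz
      rw [neg_mul, mul_comm] at hc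
      exact (mul_eq_zero.1 h2).resolve_left (sub_ne_zero.2 hc)
  · obtain ⟨v, hvS, hv, hvd⟩ := hex
    refine ⟨fun i => weyl e ψ (v i), (weight_weyl e hψ v).trans hvd, fun ⟨c, hc⟩ => ?_⟩
    change ∀ u ∈ _, ∀ w ∈ _, inner ℂ u (weylOp e ψ v w) = _ at hc
    have hinv : ∀ y ∈ stabilizerCode e ψ S χ, weylOp e ψ v y ∈ stabilizerCode e ψ S χ := by
      intro y hy
      refine (hmem _).2 fun s => ?_
      rw [← Module.End.mul_apply, weylOp_mul_comm, hv s s.2, neg_zero, AddChar.map_zero_eq_one,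
        one_smul, Module.End.mul_apply, (hmem y).1 hy, map_smul]
    have hscal : ∀ y ∈ stabilizerCode e ψ S χ, weylOp e ψ v y = c • y := by
      intro y hy
      rw [← sub_eq_zero, ← inner_self_eq_zero (𝕜 := ℂ), inner_sub_right, inner_smul_right,
        hc _ (Submodule.sub_mem _ (hinv y hy) (Submodule.smul_mem _ c hy)) y hy, sub_self]
    -- Comparing traces, the scalar vanishes, although Weyl operators are invertible.
    have htr := trace_weylOp_mul_stabilizerProj e hψ χ hvS
    have hP := isProj_stabilizerProj e hx0 hxQ
    have hvP : weylOp e ψ v * stabilizerProj e ψ S χ = c • stabilizerProj e ψ S χ :=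
      LinearMap.ext fun y => hscal _ (hP.map_mem y)
    have hrank : (Module.finrank ℂ (stabilizerCode e ψ S χ) : ℂ) ≠ 0 := by
      refine Nat.cast_ne_zero.2 fun h0 => ?_
      rw [h0, zero_mul] at hdim
      exact (Nat.pow_pos hq0).ne hdim
    rw [hvP, map_smul, hP.trace, smul_eq_mul] at htr
    have hc0 := (mul_eq_zero.1 htr).resolve_right hrank
    have h1 := inner_weylOp_weylOp e ψ v x x
    rw [hscal x hxQ, hc0, zero_smul, inner_zero_left] at h1
    exact inner_self_ne_zero.2 hx0 h1.symm

/-! ### Codes from Hermitian self-orthogonal codes -/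

section Hermitian

variable {n : ℕ} {F K : Type*} [Fintype F] [Field K]

variable (F) in
/-- The Hermitian form `∑ᵢ uᵢ vᵢ^q` on `K^n`, where `K` is a quadratic extension of the field `F`
with `q` elements. -/
def hermForm (u v : Fin n → K) : K := ∑ i, u i * v i ^ Fintype.card F

variable (F) in
theorem hermForm_smul_left (c : K) (u v : Fin n → K) :
    hermForm F (c • u) v = c * hermForm F u v := by
  simp only [hermForm, Finset.mul_sum, Pi.smul_apply, smul_eq_mul, mul_assoc]

variable [Field F] [Algebra F K] [Fintype K]

/-- The `q`-power map is an involution of the quadratic extension. -/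
theorem pow_card_pow_card (h2 : Module.finrank F K = 2) (x : K) :
    (x ^ Fintype.card F) ^ Fintype.card F = x := by
  rw [← pow_mul, ← sq, ← h2, ← Module.card_eq_pow_finrank (K := F) (V := K), FiniteField.pow_card]

/-- The norm of a quadratic extension is the power map with exponent `q + 1`. -/
theorem algebraMap_norm (h2 : Module.finrank F K = 2) (x : K) :
    algebraMap F K (Algebra.norm F x) = x ^ (Fintype.card F + 1) := by
  have h1 : 1 < Fintype.card F := Fintype.one_lt_card
  rw [FiniteField.algebraMap_norm_eq_pow, Nat.card_eq_fintype_card, Nat.card_eq_fintype_card,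
    Module.card_eq_pow_finrank (K := F) (V := K), h2, ← one_pow 2, Nat.sq_sub_sq, one_pow,
    Nat.mul_div_cancel _ (by omega)]

theorem exists_pow_card_ne (h2 : Module.finrank F K = 2) : ∃ ω : K, ω ^ Fintype.card F ≠ ω := by
  by_contra! h
  have h1 : FiniteField.frobeniusAlgHom F K = 1 := AlgHom.ext h
  have := FiniteField.orderOf_frobeniusAlgHom F K
  rw [h1, orderOf_one, h2] at this
  omega

theorem hermForm_pow (h2 : Module.finrank F K = 2) (u v : Fin n → K) :
    hermForm F u v ^ Fintype.card F = hermForm F v u := by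
  have h1 : ∀ x : K, x ^ Fintype.card F = FiniteField.frobeniusAlgHom F K x := fun x => rfl
  rw [h1, hermForm, map_sum]
  refine Finset.sum_congr rfl fun i _ => ?_
  rw [map_mul, ← h1, ← h1, pow_card_pow_card h2, mul_comm]

variable (F) in
/-- The coordinates `(a, b) ↦ a + b ω` with respect to the basis `1, ω` of a quadratic extension. -/
noncomputable def quadraticCoord (ω : K) : F × F →ₗ[F] K :=
  (Algebra.linearMap F K).coprod (LinearMap.toSpanSingleton F K ω)

omit [Fintype F] [Fintype K] in
theorem quadraticCoord_apply (ω : K) (x : F × F) :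
    quadraticCoord F ω x = algebraMap F K x.1 + algebraMap F K x.2 * ω := by
  simp [quadraticCoord, Algebra.smul_def]

omit [Fintype K] in
theorem algebraMap_pow_card (a : F) : algebraMap F K a ^ Fintype.card F = algebraMap F K a := by
  rw [← map_pow, FiniteField.pow_card]

omit [Fintype K] in
theorem quadraticCoord_pow (ω : K) (x : F × F) :
    quadraticCoord F ω x ^ Fintype.card F =
      algebraMap F K x.1 + algebraMap F K x.2 * ω ^ Fintype.card F := by
  have h1 : ∀ x : K, x ^ Fintype.card F = FiniteField.frobeniusAlgHom F K x := fun x => rfl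
  rw [quadraticCoord_apply, h1, map_add, map_mul, ← h1, ← h1, ← h1, algebraMap_pow_card,
    algebraMap_pow_card]

omit [Fintype K] in
theorem quadraticCoord_injective {ω : K} (hω : ω ^ Fintype.card F ≠ ω) :
    Function.Injective (quadraticCoord F ω) := by
  rw [injective_iff_map_eq_zero]
  intro x hx
  have hx' := quadraticCoord_pow ω x
  rw [hx, zero_pow Fintype.card_ne_zero] at hx'
  rw [quadraticCoord_apply] at hx
  have h3 : algebraMap F K x.2 * (ω ^ Fintype.card F - ω) = 0 := by
    linear_combination -hx - hx'
  have h4 := (mul_eq_zero.1 h3).resolve_right (sub_ne_zero.2 hω)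
  rw [h4, zero_mul, add_zero] at hx
  exact Prod.ext ((map_eq_zero _).1 hx) ((map_eq_zero _).1 h4)

/-- In coordinates, the symplectic form is, up to a constant, the antisymmetric part of the
Hermitian form. -/
theorem algebraMap_sympForm (ω : K) (u v : Fin n → F × F) (h2 : Module.finrank F K = 2) :
    algebraMap F K (sympForm u v) * (ω ^ Fintype.card F - ω) =
      hermForm F (fun i => quadraticCoord F ω (u i)) (fun i => quadraticCoord F ω (v i)) -
      hermForm F (fun i => quadraticCoord F ω (u i)) (fun i => quadraticCoord F ω (v i)) ^
        Fintype.card F := by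
  rw [hermForm_pow h2]
  simp only [hermForm, sympForm, map_sum, Finset.sum_mul, ← Finset.sum_sub_distrib,
    quadraticCoord_pow]
  simp only [quadraticCoord_apply, map_sub, map_mul]
  exact Finset.sum_congr rfl fun i _ => by ring

/-- **Hermitian construction.** A Hermitian self-orthogonal code over the quadratic extension, whose
Hermitian dual has minimum weight at least `d`, with weight `d` attained outside the code, yields a
quantum code. -/
theorem exists_isCode_of_hermitian {q k d : ℕ} (hF : Fintype.card F = q)
    (h2 : Module.finrank F K = 2) (C : Submodule K (Fin n → K))
    (hC : ∀ u ∈ C, ∀ v ∈ C, hermForm F u v = 0)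
    (hd : ∀ v : Fin n → K, (∀ u ∈ C, hermForm F u v = 0) → v ≠ 0 → d ≤ {i | v i ≠ 0}.ncard)
    (hex : ∃ v ∉ C, (∀ u ∈ C, hermForm F u v = 0) ∧ {i | v i ≠ 0}.ncard = d)
    (hk : 2 * Module.finrank K C + k = n) :
    ∃ Q : Submodule ℂ (QuditSpace q n), IsCode q n k d Q := by
  obtain ⟨ω, hω⟩ := exists_pow_card_ne h2
  have hω' : ω ^ Fintype.card F - ω ≠ 0 := sub_ne_zero.2 hω
  have hinj := quadraticCoord_injective hω
  let φ : (F × F) ≃ₗ[F] K := LinearEquiv.ofInjectiveOfFinrankEq (quadraticCoord F ω) hinj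
    (by rw [h2, Module.finrank_prod, Module.finrank_self])
  have hφ : ∀ x, φ x = quadraticCoord F ω x := fun x => rfl
  let Φ : (Fin n → F × F) ≃ₗ[F] (Fin n → K) := LinearEquiv.piCongrRight fun _ => φ
  have hΦ : ∀ v i, Φ v i = quadraticCoord F ω (v i) := fun v i => rfl
  have hsymp : ∀ u v, algebraMap F K (sympForm u v) * (ω ^ Fintype.card F - ω) =
      hermForm F (Φ u) (Φ v) - hermForm F (Φ u) (Φ v) ^ Fintype.card F :=
    fun u v => algebraMap_sympForm ω u v h2
  let S : Submodule F (Fin n → F × F) := (C.restrictScalars F).comap Φ.toLinearMap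
  have hS : ∀ v, v ∈ S ↔ Φ v ∈ C := fun v => Iff.rfl
  have hdual : ∀ v, (∀ s ∈ S, sympForm s v = 0) ↔ ∀ u ∈ C, hermForm F u (Φ v) = 0 := by
    refine fun v => ⟨fun h u hu => ?_, fun h s hs => ?_⟩
    -- The multiples `u` and `ω u` force `z = z ^ q` and `ω z = (ω z) ^ q` for the value `z`.
    · have key : ∀ α : K, α * hermForm F u (Φ v) = (α * hermForm F u (Φ v)) ^ Fintype.card F := by
        intro α
        have h1 := hsymp (Φ.symm (α • u)) v
        rw [h _ ((hS _).2 (by rw [Φ.apply_symm_apply]; exact C.smul_mem α hu)),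
          Φ.apply_symm_apply, hermForm_smul_left, map_zero, zero_mul] at h1
        exact sub_eq_zero.1 h1.symm
      have k1 := key 1
      have k2 := key ω
      rw [one_mul] at k1
      rw [mul_pow, ← k1] at k2
      have : (ω ^ Fintype.card F - ω) * hermForm F u (Φ v) = 0 := by linear_combination -k2
      exact (mul_eq_zero.1 this).resolve_left hω'
    · have h1 := hsymp s v
      rw [h _ ((hS s).1 hs), zero_pow Fintype.card_ne_zero, sub_zero] at h1
      exact (map_eq_zero _).1 ((mul_eq_zero.1 h1).resolve_right hω')
  have hsupp : ∀ v : Fin n → F × F, {i | Φ v i ≠ 0} = {i | v i ≠ 0} := by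
    intro v
    ext i
    simp only [Set.mem_ofPred_eq, hΦ, ne_eq, map_eq_zero_iff _ hinj]
  refine exists_isCode_of_isotropic hF S
    (fun u hu v hv => (hdual v).2 (fun w hw => hC w hw _ ((hS v).1 hv)) u hu)
    (fun v hv hv0 => ?_) ?_ ?_
  · rw [← hsupp]
    exact hd _ ((hdual v).1 hv) (fun h => hv0 (Φ.map_eq_zero_iff.1 h))
  · obtain ⟨v, hvC, hv, hvd⟩ := hex
    refine ⟨Φ.symm v, fun h => hvC ?_, (hdual _).2 ?_, ?_⟩
    · simpa using (hS _).1 h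
    · simpa using hv
    · rw [← hsupp, Φ.apply_symm_apply, hvd]
  · have h1 : Module.finrank F S = Module.finrank F (C.restrictScalars F) :=
      (Φ.ofSubmodule' (C.restrictScalars F)).finrank_eq
    have h3 : Module.finrank F (C.restrictScalars F) = 2 * Module.finrank K C := by
      rw [← h2]; exact (Module.finrank_mul_finrank F K C).symm
    rw [h1, h3, hk]

end Hermitian

open Polynomial

/-! ### Generalized Reed–Solomon codes -/

section ReedSolomon

variable {N : ℕ} {K : Type*} [Field K]

/-- The encoding map of the generalized Reed–Solomon code of dimension `r + 1`: the word of a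
polynomial `f` of degree at most `r` consists of its coefficient of degree `r`, the value at the
point at infinity, followed by its values at the points `pt i`, all of them rescaled. -/
noncomputable def grsEncode (r : ℕ) (pt : Fin N → K) (β : K) (γ : Fin N → K) :
    K[X] →ₗ[K] (Fin (N + 1) → K) where
  toFun f := Fin.cons (β * f.coeff r) fun i => γ i * f.eval (pt i)
  map_add' f g := by
    ext i
    refine Fin.cases ?_ (fun j => ?_) i <;> simp [mul_add]
  map_smul' c f := by
    ext i
    refine Fin.cases ?_ (fun j => ?_) i <;> simp [mul_left_comm]

variable {r : ℕ} {pt : Fin N → K} {β : K} {γ : Fin N → K}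

@[simp] theorem grsEncode_zero (f : K[X]) : grsEncode r pt β γ f 0 = β * f.coeff r := rfl

@[simp] theorem grsEncode_succ (f : K[X]) (i : Fin N) :
    grsEncode r pt β γ f i.succ = γ i * f.eval (pt i) := rfl

variable (r pt β γ) in
/-- The generalized Reed–Solomon code of dimension `r + 1` with points `pt i` and `∞`. -/
noncomputable def grsCode : Submodule K (Fin (N + 1) → K) :=
  (degreeLT K (r + 1)).map (grsEncode r pt β γ)

theorem finrank_grsCode (hpt : Function.Injective pt) (hγ : ∀ i, γ i ≠ 0) (hN : r + 1 ≤ N) :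
    Module.finrank K (grsCode r pt β γ) = r + 1 := by
  have hinj : Function.Injective ((grsEncode r pt β γ).domRestrict (degreeLT K (r + 1))) := by
    rw [injective_iff_map_eq_zero]
    rintro ⟨f, hf⟩ h0
    rw [mem_degreeLT] at hf
    refine Subtype.ext (eq_zero_of_degree_lt_of_eval_index_eq_zero (s := Finset.univ)
      hpt.injOn (hf.trans_le ?_) fun i _ => ?_)
    · rw [Finset.card_univ, Fintype.card_fin]; exact_mod_cast hN
    · have h1 := congrFun h0 i.succ
      rw [LinearMap.domRestrict_apply, grsEncode_succ, Pi.zero_apply] at h1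
      exact (mul_eq_zero.1 h1).resolve_left (hγ i)
  rw [grsCode, ← LinearMap.range_domRestrict, LinearMap.finrank_range_of_inj hinj,
    (degreeLTEquiv K (r + 1)).finrank_eq, Module.finrank_fin_fun]

theorem grsEncode_mem {f : K[X]} (hf : f.degree < (r + 1 : ℕ)) :
    grsEncode r pt β γ f ∈ grsCode r pt β γ :=
  Submodule.mem_map_of_mem (mem_degreeLT.2 hf)

/-- The Lagrange weights of the nodes in `s` extract the coefficient of degree `s.card - 1`; they are
orthogonal to the polynomials of smaller degree. -/
theorem sum_eval_mul_nodalWeight_eq_coeff {ι : Type*} [DecidableEq ι] {s : Finset ι} {v : ι → K}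
    (hv : Set.InjOn v s) {f : K[X]} (hf : f.degree < s.card) :
    ∑ i ∈ s, f.eval (v i) * Lagrange.nodalWeight s v i = f.coeff (s.card - 1) := by
  rw [Lagrange.coeff_eq_sum hv hf]
  refine Finset.sum_congr rfl fun i _ => ?_
  rw [Lagrange.nodalWeight, Finset.prod_inv_distrib, div_eq_mul_inv]

theorem ncard_support_succ (v : Fin (N + 1) → K) [DecidableEq K] :
    {i | v i ≠ 0}.ncard =
      (if v 0 ≠ 0 then 1 else 0) + (Finset.univ.filter fun i : Fin N => v i.succ ≠ 0).card := by
  rw [← Fin.card_filter_univ_succ' (fun i => v i ≠ 0), ← Set.ncard_coe_finset]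
  congr 1
  ext i
  simp

variable {F : Type*} [Fintype F]

theorem hermForm_grsEncode (f : K[X]) (v : Fin (N + 1) → K) :
    hermForm F (grsEncode r pt β γ f) v = β * f.coeff r * v 0 ^ Fintype.card F +
      ∑ i, γ i * f.eval (pt i) * v i.succ ^ Fintype.card F := by
  rw [hermForm, Fin.sum_univ_succ]; rfl

/-- A nonzero word of the Hermitian dual has weight at least `r + 2`: otherwise a polynomial
vanishing at all but one of the points in its support detects the remaining one. -/
theorem le_ncard_of_hermForm_eq_zero (hpt : Function.Injective pt) (hγ : ∀ i, γ i ≠ 0)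
    (hβ : β ≠ 0) {v : Fin (N + 1) → K} (hv0 : v ≠ 0)
    (hv : ∀ u ∈ grsCode r pt β γ, hermForm F u v = 0) (hF : Fintype.card F ≠ 0) :
    r + 2 ≤ {i | v i ≠ 0}.ncard := by
  classical
  by_contra! hlt
  rw [ncard_support_succ] at hlt
  set T := Finset.univ.filter fun i : Fin N => v i.succ ≠ 0 with hT
  have hTmem : ∀ i, i ∈ T ↔ v i.succ ≠ 0 := fun i => by simp [hT]
  have hTe : ∀ i : Fin N, v i.succ = 0 := by
    intro i
    by_contra hi
    have hiT := (hTmem i).2 hi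
    have hcard := Finset.card_erase_of_mem hiT
    have hpos := Finset.card_pos.2 ⟨i, hiT⟩
    have hdeg := Lagrange.degree_nodal (s := T.erase i) (v := pt)
    have h1 := hv _ (grsEncode_mem (f := Lagrange.nodal (T.erase i) pt) (by
      rw [hdeg]
      norm_cast
      split_ifs at hlt <;> omega))
    have h2 : β * (Lagrange.nodal (T.erase i) pt).coeff r * v 0 ^ Fintype.card F = 0 := by
      split_ifs at hlt with h0
      · rw [coeff_eq_zero_of_degree_lt (by rw [hdeg]; norm_cast; omega)]; ring
      · rw [not_not.1 h0, zero_pow hF, mul_zero]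
    rw [hermForm_grsEncode, h2, zero_add, Finset.sum_eq_single i] at h1
    · refine mul_ne_zero (mul_ne_zero (hγ i) ?_) (pow_ne_zero _ hi) h1
      exact Lagrange.eval_nodal_not_at_node fun j hj h =>
        (Finset.mem_erase.1 hj).1 (hpt h).symm
    · intro j _ hj
      by_cases hjT : j ∈ T
      · rw [Lagrange.eval_nodal_at_node (Finset.mem_erase.2 ⟨hj, hjT⟩)]; ring
      · rw [not_not.1 (fun h => hjT ((hTmem j).2 h)), zero_pow hF, mul_zero]
    · simp
  have h1 := hv _ (grsEncode_mem (f := X ^ r) (by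
    rw [degree_X_pow]; exact_mod_cast Nat.lt_succ_self r))
  rw [hermForm_grsEncode, Finset.sum_eq_zero, add_zero, coeff_X_pow_self, mul_one] at h1
  · refine hv0 (funext fun i => Fin.cases ?_ hTe i)
    exact (pow_eq_zero_iff hF).1 ((mul_eq_zero.1 h1).resolve_left hβ)
  · intro i _
    rw [hTe, zero_pow hF, mul_zero]

variable [Field F] [Algebra F K] [Fintype K]

/-- The Hermitian dual contains words of weight `r + 2`, given by Lagrange weights; they have too
many zeros to lie in the code itself. -/
theorem exists_ncard_eq (h2 : Module.finrank F K = 2) (hpt : Function.Injective pt)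
    (hγ : ∀ i, γ i ≠ 0) (hβ : β ≠ 0) (hN : 2 * (r + 1) ≤ N) :
    ∃ v ∉ grsCode r pt β γ, (∀ u ∈ grsCode r pt β γ, hermForm F u v = 0) ∧
      {i | v i ≠ 0}.ncard = r + 2 := by
  classical
  have hF : Fintype.card F ≠ 0 := Fintype.card_ne_zero
  obtain ⟨T, -, hT⟩ := Finset.exists_subset_card_eq (s := (Finset.univ : Finset (Fin N)))
    (n := r + 2) (by rw [Finset.card_univ, Fintype.card_fin]; omega)
  let y : Fin N → K := fun i =>
    if i ∈ T then (Lagrange.nodalWeight T pt i * (γ i)⁻¹) ^ Fintype.card F else 0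
  have hy : ∀ i, y i ≠ 0 ↔ i ∈ T := by
    intro i
    by_cases hi : i ∈ T
    · simp only [y, if_pos hi, hi, iff_true]
      exact pow_ne_zero _ (mul_ne_zero (Lagrange.nodalWeight_ne_zero hpt.injOn hi)
        (inv_ne_zero (hγ i)))
    · simp [y, hi]
  let v : Fin (N + 1) → K := Fin.cons 0 y
  have hv0 : v 0 = 0 := rfl
  have hvs : ∀ i, v (Fin.succ i) = y i := fun i => rfl
  refine ⟨v, ?_, ?_, ?_⟩
  · rintro ⟨f, hf, hfv⟩
    rw [SetLike.mem_coe, mem_degreeLT] at hf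
    have hfr : f.coeff r = 0 := by
      have h1 := congrFun hfv 0
      rw [grsEncode_zero, hv0] at h1
      exact (mul_eq_zero.1 h1).resolve_left hβ
    have hdeg : f.degree < r := by
      rw [degree_lt_iff_coeff_zero] at hf ⊢
      intro m hm
      rcases hm.eq_or_lt with rfl | hlt
      · exact hfr
      · exact hf m hlt
    have hf0 : f = 0 := by
      refine eq_zero_of_degree_lt_of_eval_index_eq_zero (s := Tᶜ) hpt.injOn
        (hdeg.trans_le ?_) fun i hi => ?_
      · rw [Finset.card_compl, Fintype.card_fin, hT]
        norm_cast
        omega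
      · have h1 := congrFun hfv i.succ
        rw [grsEncode_succ, hvs, not_not.1 (fun h => Finset.mem_compl.1 hi ((hy i).1 h))] at h1
        exact (mul_eq_zero.1 h1).resolve_left (hγ i)
    obtain ⟨i, hi⟩ := Finset.card_pos.1 (by omega : 0 < T.card)
    refine (hy i).2 hi ?_
    rw [← hvs, ← hfv, hf0, map_zero, Pi.zero_apply]
  · rintro _ ⟨f, hf, rfl⟩
    rw [SetLike.mem_coe, mem_degreeLT] at hf
    have hlt : f.degree < T.card := hf.trans (by rw [hT]; exact_mod_cast Nat.lt_succ_self _)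
    have h1 := sum_eval_mul_nodalWeight_eq_coeff (hpt.injOn (s := T)) hlt
    rw [hT, coeff_eq_zero_of_degree_lt (by exact_mod_cast hf)] at h1
    rw [hermForm_grsEncode, hv0, zero_pow hF, mul_zero, zero_add, ← h1]
    rw [← Finset.sum_subset (Finset.subset_univ T)]
    · refine Finset.sum_congr rfl fun i hi => ?_
      have := hγ i
      rw [hvs]
      simp only [y, if_pos hi]
      rw [pow_card_pow_card h2]
      field_simp
    · intro i _ hi
      rw [hvs, not_not.1 (fun h => hi ((hy i).1 h)), zero_pow hF, mul_zero]
  · rw [ncard_support_succ, hv0, if_neg (not_not.2 rfl), zero_add, ← hT]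
    congr 1
    ext i
    simp [hvs, hy]

theorem exists_pow_succ_eq (h2 : Module.finrank F K = 2) (a : F) :
    ∃ z : K, z ^ (Fintype.card F + 1) = algebraMap F K a := by
  obtain ⟨z, rfl⟩ := FiniteField.norm_surjective F K a
  refine ⟨z, ?_⟩
  rw [algebraMap_norm h2]

/-- **Quantum Reed–Solomon codes.** If weights `wᵢ` in `F` make the rows `xᵢ ^ a` (`a ≤ r`)
orthogonal for the weighted Hermitian form, except that the last row has nonzero norm, then adding
the point at infinity gives a Hermitian self-orthogonal code, hence a quantum code. -/
theorem exists_isCode_of_weights {q k : ℕ} (hF : Fintype.card F = q)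
    (h2 : Module.finrank F K = 2) (hpt : Function.Injective pt) {w : Fin N → F}
    (hw : ∀ i, w i ≠ 0) {c : F} (hc : c ≠ 0) (hN : 2 * (r + 1) ≤ N)
    (hsum : ∀ a ≤ r, ∀ b ≤ r, ∑ i, algebraMap F K (w i) * pt i ^ (a + q * b) =
      if a = r ∧ b = r then algebraMap F K c else 0) (hk : 2 * (r + 1) + k = N + 1) :
    ∃ Q : Submodule ℂ (QuditSpace q (N + 1)), IsCode q (N + 1) k (r + 2) Q := by
  choose z hz using exists_pow_succ_eq (F := F) (K := K) h2
  have hz0 : ∀ a, a ≠ 0 → z a ≠ 0 := by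
    intro a ha h0
    have := hz a
    rw [h0, zero_pow (Nat.succ_ne_zero _)] at this
    exact ha ((map_eq_zero _).1 this.symm)
  have hγ : ∀ i, z (w i) ≠ 0 := fun i => hz0 _ (hw i)
  have hβ : z (-c) ≠ 0 := hz0 _ (neg_ne_zero.2 hc)
  refine exists_isCode_of_hermitian hF h2 (grsCode r pt (z (-c)) fun i => z (w i)) ?_
    (fun v hv hv0 => le_ncard_of_hermForm_eq_zero hpt hγ hβ hv0 hv Fintype.card_ne_zero)
    (exists_ncard_eq h2 hpt hγ hβ hN) (by rw [finrank_grsCode hpt hγ (by omega), hk])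
  rintro _ ⟨f, hf, rfl⟩ _ ⟨g, hg, rfl⟩
  rw [SetLike.mem_coe, mem_degreeLT, degree_lt_iff_coeff_zero] at hf hg
  have hev : ∀ h : K[X], (∀ m : ℕ, r + 1 ≤ m → h.coeff m = 0) → ∀ x,
      h.eval x = ∑ a ∈ Finset.range (r + 1), h.coeff a * x ^ a := by
    intro h hh x
    refine eval_eq_sum_range' ?_ x
    rw [Nat.lt_succ_iff, natDegree_le_iff_coeff_eq_zero]
    exact hh
  have hpow : ∀ x : K, (g.eval x) ^ q =
      ∑ b ∈ Finset.range (r + 1), g.coeff b ^ q * x ^ (q * b) := by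
    intro x
    have h1 : ∀ x : K, x ^ q = FiniteField.frobeniusAlgHom F K x := fun x => by rw [← hF]; rfl
    rw [hev g hg, h1, map_sum]
    refine Finset.sum_congr rfl fun b _ => ?_
    rw [map_mul, ← h1, ← h1, ← pow_mul, mul_comm b q]
  rw [hermForm_grsEncode, hF, grsEncode_zero]
  simp only [grsEncode_succ, mul_pow, hpow]
  have hterm : ∀ i, z (w i) * f.eval (pt i) * (z (w i) ^ q *
      ∑ b ∈ Finset.range (r + 1), g.coeff b ^ q * pt i ^ (q * b)) =
      ∑ a ∈ Finset.range (r + 1), ∑ b ∈ Finset.range (r + 1),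
        f.coeff a * g.coeff b ^ q * (algebraMap F K (w i) * pt i ^ (a + q * b)) := by
    intro i
    rw [hev f hf, ← hz, hF]
    simp only [Finset.mul_sum, Finset.sum_mul]
    rw [Finset.sum_comm]
    refine Finset.sum_congr rfl fun a _ => Finset.sum_congr rfl fun b _ => ?_
    ring
  simp only [hterm]
  have hswap : ∑ i, ∑ a ∈ Finset.range (r + 1), ∑ b ∈ Finset.range (r + 1),
      f.coeff a * g.coeff b ^ q * (algebraMap F K (w i) * pt i ^ (a + q * b)) =
      f.coeff r * g.coeff r ^ q * algebraMap F K c := by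
    rw [Finset.sum_comm]
    have h3 : ∀ a ∈ Finset.range (r + 1), ∑ i, ∑ b ∈ Finset.range (r + 1),
        f.coeff a * g.coeff b ^ q * (algebraMap F K (w i) * pt i ^ (a + q * b)) =
        ∑ b ∈ Finset.range (r + 1), f.coeff a * g.coeff b ^ q *
          (if a = r ∧ b = r then algebraMap F K c else 0) := by
      intro a ha
      rw [Finset.sum_comm]
      refine Finset.sum_congr rfl fun b hb => ?_
      rw [← Finset.mul_sum, hsum a (Finset.mem_range_succ_iff.1 ha) b
        (Finset.mem_range_succ_iff.1 hb)]
    rw [Finset.sum_congr rfl h3, Finset.sum_eq_single r, Finset.sum_eq_single r]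
    · simp
    · intro b _ hb; rw [if_neg (fun h => hb h.2), mul_zero]
    · simp
    · intro a _ ha
      exact Finset.sum_eq_zero fun b _ => by rw [if_neg (fun h => ha h.1), mul_zero]
    · simp
  rw [hswap]
  have hzc := hz (-c)
  rw [hF, map_neg, pow_succ] at hzc
  linear_combination f.coeff r * g.coeff r ^ q * hzc

end ReedSolomon

/-! ### Weights on the base field -/

section BaseField

variable {F : Type*} [Field F] [Fintype F]

/-- On a proper subset of `F` there are nonvanishing monic polynomials of every degree; on `F`
itself of every degree but one, since for `s ≥ 2` the map `x ↦ x ^ s - x ^ (s - 1)` takes the same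
value at `0` and `1`, so it is not surjective. -/
theorem exists_monic_forall_eval_ne_zero (A : Finset F) (s : ℕ)
    (h : s ≠ 1 ∨ A.card < Fintype.card F) :
    ∃ f : F[X], f.Monic ∧ f.natDegree = s ∧ ∀ a ∈ A, f.eval a ≠ 0 := by
  match s with
  | 0 => exact ⟨1, monic_one, natDegree_one, by simp⟩
  | 1 =>
    obtain ⟨b, hb⟩ : ∃ b, b ∉ A := by
      by_contra! hA
      rw [Finset.eq_univ_of_forall hA, Finset.card_univ] at h
      omega
    refine ⟨X - C b, monic_X_sub_C b, natDegree_X_sub_C b, fun a ha h0 => hb ?_⟩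
    rw [eval_sub, eval_X, eval_C, sub_eq_zero] at h0
    exact h0 ▸ ha
  | m + 2 =>
    have hns : ¬ Function.Surjective fun x : F => x ^ (m + 2) - x ^ (m + 1) := by
      rw [← Finite.injective_iff_surjective]
      intro hinj
      exact zero_ne_one (hinj (a₁ := (0 : F)) (a₂ := 1) (by simp))
    obtain ⟨c, hc⟩ := not_forall.1 hns
    have hdeg : (X ^ (m + 1) + C c : F[X]).degree < ((m + 2 : ℕ) : WithBot ℕ) := by
      refine (degree_add_le _ _).trans_lt (max_lt ?_ ?_)
      · rw [degree_X_pow]; exact_mod_cast Nat.lt_succ_self _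
      · exact degree_C_le.trans_lt (by exact_mod_cast Nat.succ_pos _)
    refine ⟨X ^ (m + 2) - (X ^ (m + 1) + C c), monic_X_pow_sub hdeg, ?_, fun a _ h0 => ?_⟩
    · refine natDegree_eq_of_degree_eq_some ?_
      rw [degree_sub_eq_left_of_degree_lt (by rwa [degree_X_pow]), degree_X_pow]
    · refine hc ⟨a, ?_⟩
      simp only [eval_sub, eval_add, eval_pow, eval_X, eval_C] at h0
      linear_combination h0

/-- Weights supported on `A` that annihilate the powers `a ^ i` for `i < r` but not `a ^ r`: the
Lagrange weights of `A` multiplied by the values of a nonvanishing polynomial of the complementary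
degree. -/
theorem exists_weights [DecidableEq F] (A : Finset F) {t r : ℕ} (hA : A.card = t + 1) (hr : r ≤ t)
    (h : t - r ≠ 1 ∨ t + 1 < Fintype.card F) :
    ∃ W : F → F, (∀ a, W a ≠ 0 ↔ a ∈ A) ∧
      ∀ i ≤ r, ∑ a, W a * a ^ i = if i = r then 1 else 0 := by
  obtain ⟨f, hf, hfd, hf0⟩ := exists_monic_forall_eval_ne_zero A (t - r) (hA ▸ h)
  refine ⟨fun a => if a ∈ A then f.eval a * Lagrange.nodalWeight A id a else 0, fun a => ?_,
    fun i hi => ?_⟩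
  · by_cases ha : a ∈ A
    · simp only [ha, if_true, iff_true]
      exact mul_ne_zero (hf0 a ha) (Lagrange.nodalWeight_ne_zero Function.injective_id.injOn ha)
    · simp [ha]
  · have hm : (f * X ^ i).Monic := hf.mul (monic_X_pow i)
    have hd : (f * X ^ i).natDegree = t - r + i := by
      rw [hf.natDegree_mul (monic_X_pow i), hfd, natDegree_X_pow]
    have h1 := sum_eval_mul_nodalWeight_eq_coeff (s := A) (v := id) (f := f * X ^ i)
      Function.injective_id.injOn (by
        rw [degree_eq_natDegree hm.ne_zero, hd, hA]; norm_cast; omega)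
    have h2 : (f * X ^ i).coeff (A.card - 1) = if i = r then 1 else 0 := by
      rw [hA, Nat.add_sub_cancel]
      split_ifs with hir
      · rw [show t = (f * X ^ i).natDegree by rw [hd]; omega]
        exact hm.coeff_natDegree
      · exact coeff_eq_zero_of_natDegree_lt (by rw [hd]; omega)
    rw [← h2, ← h1, ← Finset.sum_subset (Finset.subset_univ A)]
    · refine Finset.sum_congr rfl fun a ha => ?_
      simp only [if_pos ha, id, eval_mul, eval_pow, eval_X]
      ring
    · intro a _ ha
      simp [ha]

end BaseField

/-! ### Norm fibres and power sums -/

section Norm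

variable {F K : Type*} [Field F] [Fintype F] [Field K] [Fintype K] [Algebra F K]

theorem card_filter_norm_eq [DecidableEq F] (h2 : Module.finrank F K = 2) {y : F} (hy : y ≠ 0) :
    (Finset.univ.filter fun x : K => Algebra.norm F x = y).card = Fintype.card F + 1 := by
  classical
  have hfib : ∀ y : F, y ≠ 0 → (Finset.univ.filter fun x : K => Algebra.norm F x = y).card =
      (Finset.univ.filter fun x : K => Algebra.norm F x = 1).card := by
    intro y hy
    obtain ⟨z, rfl⟩ := FiniteField.norm_surjective F K y
    have hz : z ≠ 0 := fun h => hy (by rw [h, Algebra.norm_zero])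
    refine (Finset.card_nbij' (fun x => z * x) (fun x => z⁻¹ * x) ?_ ?_ ?_ ?_).symm
    · intro x hx
      simp only [Finset.coe_filter, Finset.mem_univ, true_and, Set.mem_ofPred_eq] at hx ⊢
      rw [map_mul, hx, mul_one]
    · intro x hx
      simp only [Finset.coe_filter, Finset.mem_univ, true_and, Set.mem_ofPred_eq] at hx ⊢
      rw [map_mul, hx, ← map_mul, inv_mul_cancel₀ hz, map_one]
    · intro x _; exact inv_mul_cancel_left₀ hz x
    · intro x _; exact mul_inv_cancel_left₀ hz x
  have h0 : (Finset.univ.filter fun x : K => Algebra.norm F x = 0).card = 1 := by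
    rw [Finset.card_eq_one]
    exact ⟨0, by ext x; simp [Algebra.norm_eq_zero_iff]⟩
  have htot := Finset.card_eq_sum_card_fiberwise (f := fun x : K => Algebra.norm F x)
    (s := Finset.univ) (t := Finset.univ) (fun _ _ => Finset.mem_coe.2 (Finset.mem_univ _))
  rw [← Finset.add_sum_erase _ _ (Finset.mem_univ (0 : F)), h0,
    Finset.sum_congr rfl (fun y hy => hfib y (Finset.ne_of_mem_erase hy)), Finset.sum_const,
    Finset.card_erase_of_mem (Finset.mem_univ _), Finset.card_univ, Finset.card_univ,
    Module.card_eq_pow_finrank (K := F) (V := K), h2, smul_eq_mul] at htot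
  rw [hfib y hy]
  obtain ⟨m, hm⟩ : ∃ m, Fintype.card F = m + 2 :=
    ⟨Fintype.card F - 2, by have := Fintype.one_lt_card (α := F); omega⟩
  rw [hm] at htot ⊢
  refine Nat.eq_of_mul_eq_mul_left (Nat.succ_pos m) ?_
  rw [show m + 2 - 1 = m + 1 by omega] at htot
  simp only [Nat.succ_eq_add_one]
  nlinarith

theorem card_filter_norm_mem [DecidableEq F] (h2 : Module.finrank F K = 2) {A : Finset F}
    (h0 : (0 : F) ∈ A) {t : ℕ} (hA : A.card = t + 1) :
    (Finset.univ.filter fun x : K => Algebra.norm F x ∈ A).card =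
      t * (Fintype.card F + 1) + 1 := by
  classical
  rw [Finset.card_eq_sum_card_fiberwise (f := fun x : K => Algebra.norm F x) (t := A)
    (fun x hx => by simpa using hx)]
  have h1 : ∀ y ∈ A, ((Finset.univ.filter fun x : K => Algebra.norm F x ∈ A).filter
      fun x => Algebra.norm F x = y).card =
      (Finset.univ.filter fun x : K => Algebra.norm F x = y).card := by
    intro y hy
    congr 1
    ext x
    simp only [Finset.mem_filter, Finset.mem_univ, true_and]
    exact ⟨fun h => h.2, fun h => ⟨h ▸ hy, h⟩⟩
  rw [Finset.sum_congr rfl h1, ← Finset.add_sum_erase _ _ h0,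
    Finset.sum_congr rfl (fun y hy => card_filter_norm_eq h2 (Finset.ne_of_mem_erase hy)),
    Finset.sum_const, Finset.card_erase_of_mem h0, hA, Nat.add_sub_cancel, smul_eq_mul, add_comm]
  congr 1
  rw [Finset.card_eq_one]
  exact ⟨0, by ext x; simp [Algebra.norm_eq_zero_iff]⟩

theorem sum_comp_norm (h2 : Module.finrank F K = 2) (f : F → F) :
    ∑ x : K, f (Algebra.norm F x) = ∑ y, f y := by
  classical
  rw [← Finset.sum_fiberwise Finset.univ (fun x : K => Algebra.norm F x)]
  refine Finset.sum_congr rfl fun y _ => ?_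
  rw [Finset.sum_congr rfl (g := fun _ => f y)
    (fun x hx => by rw [(Finset.mem_filter.1 hx).2]), Finset.sum_const]
  by_cases hy : y = 0
  · subst hy
    rw [Finset.card_eq_one.2 ⟨0, by ext x; simp [Algebra.norm_eq_zero_iff]⟩, one_smul]
  · rw [card_filter_norm_eq h2 hy, nsmul_eq_mul]
    push_cast
    rw [FiniteField.cast_card_eq_zero, zero_add, one_mul]

/-- The elements of norm one separate the exponents `a + q b` and `b + q b` as long as
`|a - b| ≤ q`. -/
theorem exists_norm_eq_one_pow_ne_one (h2 : Module.finrank F K = 2) {a b : ℕ}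
    (ha : a ≤ Fintype.card F) (hb : b ≤ Fintype.card F) (hab : a ≠ b) :
    ∃ u : K, Algebra.norm F u = 1 ∧ u ^ (a + Fintype.card F * b) ≠ 1 := by
  obtain ⟨g, hg⟩ := IsCyclic.exists_generator (α := Kˣ)
  obtain ⟨m, hm⟩ : ∃ m, Fintype.card F = m + 2 :=
    ⟨Fintype.card F - 2, by have := Fintype.one_lt_card (α := F); omega⟩
  have hord : orderOf g = (m + 1) * (m + 3) := by
    rw [orderOf_eq_card_of_forall_mem_zpowers hg, Nat.card_units, Nat.card_eq_fintype_card,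
      Module.card_eq_pow_finrank (K := F) (V := K), h2, hm]
    refine Nat.sub_eq_of_eq_add ?_
    ring
  refine ⟨((g ^ (m + 1) : Kˣ) : K), ?_, fun h => ?_⟩
  · refine (algebraMap F K).injective ?_
    rw [algebraMap_norm h2, map_one, ← Units.val_pow_eq_pow_val, ← pow_mul, hm,
      show m + 2 + 1 = m + 3 by omega, ← hord, pow_orderOf_eq_one, Units.val_one]
  · rw [← Units.val_pow_eq_pow_val, ← pow_mul, Units.val_eq_one, ← orderOf_dvd_iff_pow_eq_one,
      hord, hm] at h
    have h3 : m + 3 ∣ a + (m + 2) * b := Nat.dvd_of_mul_dvd_mul_left (Nat.succ_pos m) h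
    rw [hm] at ha hb
    have h4 : ((m + 3 : ℕ) : ℤ) ∣ (a : ℤ) - b := by
      have h5 : ((m + 3 : ℕ) : ℤ) ∣ ((a + (m + 2) * b : ℕ) : ℤ) := by exact_mod_cast h3
      have h6 : (a : ℤ) - b = ((a + (m + 2) * b : ℕ) : ℤ) - ((m + 3 : ℕ) : ℤ) * b := by
        push_cast; ring
      rw [h6]
      exact dvd_sub h5 (dvd_mul_right _ _)
    have h7 : (a : ℤ) - b = 0 := by
      refine Int.eq_zero_of_abs_lt_dvd h4 ?_
      rw [abs_lt]
      push_cast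
      omega
    omega

/-- For weights depending on the norm only, different rows `x ^ a` and `x ^ b` are orthogonal: the
sum is multiplied by `u ^ (a + q b) ≠ 1` under the substitution `x ↦ u x`. -/
theorem sum_norm_weight_mul_pow (h2 : Module.finrank F K = 2) (W : F → F) {a b : ℕ}
    (ha : a ≤ Fintype.card F) (hb : b ≤ Fintype.card F) :
    ∑ x : K, algebraMap F K (W (Algebra.norm F x)) * x ^ (a + Fintype.card F * b) =
      if a = b then algebraMap F K (∑ y, W y * y ^ a) else 0 := by
  split_ifs with hab
  · subst hab
    rw [← sum_comp_norm (K := K) h2, map_sum]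
    refine Finset.sum_congr rfl fun x _ => ?_
    rw [map_mul, map_pow, algebraMap_norm h2, ← pow_mul]
    congr 2
    ring
  · obtain ⟨u, hu1, hu⟩ := exists_norm_eq_one_pow_ne_one (K := K) h2 ha hb hab
    have hu0 : u ≠ 0 := fun h => by simp [h] at hu1
    have h1 := Equiv.sum_comp (Equiv.mulLeft₀ u hu0)
      fun x : K => algebraMap F K (W (Algebra.norm F x)) * x ^ (a + Fintype.card F * b)
    simp only [Equiv.mulLeft₀_apply, map_mul, hu1, one_mul, mul_pow,
      mul_left_comm _ (u ^ _), ← Finset.mul_sum] at h1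
    have h3 : (u ^ (a + Fintype.card F * b) - 1) *
        ∑ x : K, algebraMap F K (W (Algebra.norm F x)) * x ^ (a + Fintype.card F * b) = 0 := by
      linear_combination h1
    exact (mul_eq_zero.1 h3).resolve_left (sub_ne_zero.2 hu)

end Norm

/-! ### Quantum codes from weights on the quadratic extension -/

section Weights

variable {F K : Type*} [Field F] [Fintype F] [Field K] [Fintype K] [Algebra F K]

theorem exists_isCode_of_weight_function [DecidableEq F] {q k N r : ℕ} (hF : Fintype.card F = q)
    (h2 : Module.finrank F K = 2) {w : K → F}
    (hw : (Finset.univ.filter fun x : K => w x ≠ 0).card = N) {c : F} (hc : c ≠ 0)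
    (hN : 2 * (r + 1) ≤ N)
    (hsum : ∀ a ≤ r, ∀ b ≤ r, ∑ x, algebraMap F K (w x) * x ^ (a + q * b) =
      if a = r ∧ b = r then algebraMap F K c else 0) (hk : 2 * (r + 1) + k = N + 1) :
    ∃ Q : Submodule ℂ (QuditSpace q (N + 1)), IsCode q (N + 1) k (r + 2) Q := by
  let e := (Finset.univ.filter fun x : K => w x ≠ 0).equivFinOfCardEq hw
  refine exists_isCode_of_weights (pt := fun i => (e.symm i : K)) (w := fun i => w (e.symm i)) hF h2
    (Subtype.val_injective.comp e.symm.injective)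
    (fun i => (Finset.mem_filter.1 (e.symm i).2).2) hc hN (fun a ha b hb => ?_) hk
  rw [← hsum a ha b hb, Equiv.sum_comp e.symm
    fun x => algebraMap F K (w (x : K)) * (x : K) ^ (a + q * b),
    Finset.sum_coe_sort _ fun x : K => algebraMap F K (w x) * x ^ (a + q * b)]
  refine Finset.sum_subset (Finset.subset_univ _) fun x _ hx => ?_
  rw [not_not.1 (fun h => hx (Finset.mem_filter.2 ⟨Finset.mem_univ _, h⟩)), map_zero, zero_mul]

theorem exists_isCode_of_norm_weights {q k t r : ℕ} (hF : Fintype.card F = q)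
    (h2 : Module.finrank F K = 2) (ht : 1 ≤ t) (htq : t + 1 ≤ q) (hr : r ≤ t)
    (h : t - r ≠ 1 ∨ t + 1 < q) (hk : 2 * (r + 1) + k = t * (q + 1) + 2) :
    ∃ Q : Submodule ℂ (QuditSpace q (t * (q + 1) + 2)),
      IsCode q (t * (q + 1) + 2) k (r + 2) Q := by
  classical
  obtain ⟨A, h0A, -, hA⟩ := Finset.exists_subsuperset_card_eq (Finset.subset_univ {(0 : F)})
    (n := t + 1) (by simp) (by rw [Finset.card_univ, hF]; exact htq)
  obtain ⟨W, hWA, hW⟩ := exists_weights A hA hr (hF ▸ h)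
  refine exists_isCode_of_weight_function (N := t * (q + 1) + 1)
    (w := fun x : K => W (Algebra.norm F x)) hF h2 ?_ (one_ne_zero (α := F)) ?_ ?_ hk
  · simp only [hWA]
    rw [card_filter_norm_mem h2 (h0A (Finset.mem_singleton_self 0)) hA, hF]
  · nlinarith
  · intro a ha b hb
    have h1 := sum_norm_weight_mul_pow (K := K) h2 W (a := a) (b := b) (by omega) (by omega)
    rw [hF] at h1
    rw [h1, hW a ha]
    by_cases hab : a = b
    · subst hab
      by_cases har : a = r <;> simp [har]
    · rw [if_neg hab, if_neg (fun h => hab (h.1.trans h.2.symm))]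

theorem algebraMap_trace (h2 : Module.finrank F K = 2) (x : K) :
    algebraMap F K (Algebra.trace F K x) = x + x ^ Fintype.card F := by
  rw [FiniteField.algebraMap_trace_eq_sum_pow, h2]
  simp [Finset.sum_range_succ]

/-- In odd characteristic the form `Tr(x) ^ 2 - η` with `η` a nonsquare has no zero. Its only
monomial contributing to the weighted Hermitian form is `2 x ^ (q + 1)`, and only at the last
row. -/
theorem exists_isCode_of_trace_weights {q k : ℕ} (hF : Fintype.card F = q)
    (h2 : Module.finrank F K = 2) (hchar : ringChar F ≠ 2) {r : ℕ} (hr : r + 2 = q)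
    (hk : 2 * (r + 1) + k = q ^ 2 + 1) :
    ∃ Q : Submodule ℂ (QuditSpace q (q ^ 2 + 1)), IsCode q (q ^ 2 + 1) k (r + 2) Q := by
  classical
  have hK : Fintype.card K = q ^ 2 := by
    rw [Module.card_eq_pow_finrank (K := F) (V := K), h2, hF]
  obtain ⟨η, hη⟩ := FiniteField.exists_nonsquare hchar
  have hsum0 : ∀ e, e < q ^ 2 - 1 → ∑ x : K, x ^ e = 0 := fun e he =>
    FiniteField.sum_pow_lt_card_sub_one K e (hK ▸ he)
  have hsumtop : ∑ x : K, x ^ (q ^ 2 - 1) = -1 := by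
    have hne : q ^ 2 - 1 ≠ 0 := by
      have : 2 ^ 2 ≤ q ^ 2 := Nat.pow_le_pow_left (by omega) 2
      omega
    rw [← Finset.add_sum_erase _ _ (Finset.mem_univ (0 : K)), zero_pow hne, zero_add,
      Finset.sum_congr rfl (g := fun _ => (1 : K)) (fun x hx => by
        rw [← hK, FiniteField.pow_card_sub_one_eq_one x (Finset.ne_of_mem_erase hx)]),
      Finset.sum_const, Finset.card_erase_of_mem (Finset.mem_univ _), Finset.card_univ,
      nsmul_one, Nat.cast_sub Fintype.card_pos, FiniteField.cast_card_eq_zero]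
    simp
  subst hr
  refine exists_isCode_of_weight_function (w := fun x : K => Algebra.trace F K x ^ 2 - η) hF h2 ?_
    (c := -2) (neg_ne_zero.2 (Ring.two_ne_zero hchar)) ?_ ?_ hk
  · rw [Finset.filter_true_of_mem, Finset.card_univ, hK]
    exact fun x _ h0 => hη ⟨Algebra.trace F K x, by rw [← sq]; exact (sub_eq_zero.1 h0).symm⟩
  · nlinarith
  · intro a ha b hb
    have hexp : ∀ x : K, algebraMap F K (Algebra.trace F K x ^ 2 - η) * x ^ (a + (r + 2) * b) =
        x ^ (a + 2 + (r + 2) * b) + 2 * x ^ (a + 1 + (r + 2) * (b + 1)) +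
          x ^ (a + (r + 2) * (b + 2)) - algebraMap F K η * x ^ (a + (r + 2) * b) := by
      intro x
      rw [map_sub, map_pow, algebraMap_trace h2, hF]
      ring
    have hq : (r + 2) ^ 2 - 1 = r * r + 4 * r + 3 := by
      refine Nat.sub_eq_of_eq_add ?_
      ring
    have hmul : (r + 2) * b ≤ (r + 2) * r := Nat.mul_le_mul_left _ hb
    have e1 : ∑ x : K, x ^ (a + 2 + (r + 2) * b) = 0 := hsum0 _ (by rw [hq]; nlinarith)
    have e4 : ∑ x : K, x ^ (a + (r + 2) * b) = 0 := hsum0 _ (by rw [hq]; nlinarith)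
    have e3 : ∑ x : K, x ^ (a + (r + 2) * (b + 2)) = 0 := by
      rcases hb.eq_or_lt with rfl | hlt
      -- For `b + 2 = q` the exponent is `a + q ^ 2`, and `x ^ (q ^ 2) = x`.
      · rw [Finset.sum_congr rfl (g := fun x => x ^ (a + 1))]
        · exact hsum0 _ (by rw [hq]; nlinarith)
        · intro x _
          rw [pow_add, ← sq, ← hK, FiniteField.pow_card, pow_succ]
      · have : (r + 2) * (b + 1) ≤ (r + 2) * r := Nat.mul_le_mul_left _ hlt
        exact hsum0 _ (by rw [hq]; nlinarith)
    have e2 : ∑ x : K, x ^ (a + 1 + (r + 2) * (b + 1)) = if a = r ∧ b = r then -1 else 0 := by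
      split_ifs with hab
      · rw [hab.1, hab.2, show r + 1 + (r + 2) * (r + 1) = (r + 2) ^ 2 - 1 by rw [hq]; ring]
        exact hsumtop
      · refine hsum0 _ ?_
        rw [hq]
        rcases hb.eq_or_lt with rfl | hlt
        · have : a < b := lt_of_le_of_ne ha fun h => hab ⟨h, rfl⟩
          nlinarith
        · have : (r + 2) * (b + 1) ≤ (r + 2) * r := Nat.mul_le_mul_left _ hlt
          nlinarith
    simp only [hexp, Finset.sum_sub_distrib, Finset.sum_add_distrib, ← Finset.mul_sum, e1, e2, e3,
      e4]
    split_ifs <;> simp [map_ofNat]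

end Weights

end QuantumCode

theorem theorem2 (p m q : ℕ) (hp : p.Prime) (hm : 1 ≤ m) (hq : q = p ^ m) :
    (∀ t d : ℕ, 1 ≤ t → t ≤ q - 1 → 2 ≤ d → d ≤ t + 2 → (p, t, d) ≠ (2, q - 1, q) →
      ∃ k : ℕ, (k : ℤ) = t * (q + 1) - 2 * d + 4 ∧
        ∃ Q : Submodule ℂ (QuantumCode.QuditSpace q (t * (q + 1) + 2)),
          QuantumCode.IsMDSCode q (t * (q + 1) + 2) k d Q) ∧
    (∀ d : ℕ, 2 ≤ d → d ≤ q + 1 → ¬ (Even q ∧ d = q) →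
      ∃ k : ℕ, (k : ℤ) = q ^ 2 + 3 - 2 * d ∧
        ∃ Q : Submodule ℂ (QuantumCode.QuditSpace q (q ^ 2 + 1)),
          QuantumCode.IsMDSCode q (q ^ 2 + 1) k d Q) := by
  have := Fact.mk hp
  have hm0 : m ≠ 0 := by omega
  let F := GaloisField p m
  let K := FiniteField.Extension F p 2
  let := Fintype.ofFinite F
  let := Fintype.ofFinite K
  have hF : Fintype.card F = q := by
    rw [← Nat.card_eq_fintype_card, GaloisField.card p m hm0, hq]
  have h2 : Module.finrank F K = 2 := FiniteField.finrank_extension F p 2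
  have hq2 : 2 ≤ q := hq ▸ hp.two_le.trans (Nat.le_self_pow hm0 p)
  have hn : (q - 1) * (q + 1) + 2 = q ^ 2 + 1 := by
    obtain ⟨s, rfl⟩ : ∃ s, q = s + 1 := ⟨q - 1, by omega⟩
    rw [Nat.add_sub_cancel]
    ring
  have main : ∀ t d : ℕ, 1 ≤ t → t ≤ q - 1 → 2 ≤ d → d ≤ t + 2 → (p, t, d) ≠ (2, q - 1, q) →
      ∃ k : ℕ, (k : ℤ) = t * (q + 1) - 2 * d + 4 ∧
        ∃ Q : Submodule ℂ (QuantumCode.QuditSpace q (t * (q + 1) + 2)),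
          QuantumCode.IsMDSCode q (t * (q + 1) + 2) k d Q := by
    intro t d ht1 htq hd2 hdt hne
    obtain ⟨r, rfl⟩ : ∃ r, d = r + 2 := ⟨d - 2, by omega⟩
    have hN : 2 * (r + 1) ≤ t * (q + 1) + 2 := by nlinarith
    obtain ⟨k, hk⟩ := Nat.exists_eq_add_of_le hN
    refine ⟨k, ?_, ?_⟩
    · zify at hk
      push_cast
      linarith
    suffices h : ∃ Q : Submodule ℂ (QuantumCode.QuditSpace q (t * (q + 1) + 2)),
        QuantumCode.IsCode q (t * (q + 1) + 2) k (r + 2) Q by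
      obtain ⟨Q, hQ⟩ := h
      exact ⟨Q, hQ, by omega⟩
    by_cases hex : t - r ≠ 1 ∨ t + 1 < q
    · exact QuantumCode.exists_isCode_of_norm_weights (K := K) hF h2 ht1 (by omega) (by omega) hex
        hk.symm
    -- The remaining case is `d = q` at full length, where `p` has to be odd.
    · have ht : t = q - 1 := by omega
      have hr : r + 2 = q := by omega
      have hp2 : p ≠ 2 := fun h => hne (by rw [h, ht, hr])
      have hchar : ringChar F ≠ 2 := by rwa [ringChar.eq F p]
      subst ht
      rw [hn] at hk ⊢
      exact QuantumCode.exists_isCode_of_trace_weights (K := K) hF h2 hchar hr hk.symm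
  refine ⟨main, fun d hd2 hdq hne => ?_⟩
  have hne' : (p, q - 1, d) ≠ (2, q - 1, q) := fun h => by
    simp only [Prod.mk.injEq, true_and] at h
    refine hne ⟨?_, h.2⟩
    rw [hq, h.1]
    exact even_two.pow_of_ne_zero hm0
  obtain ⟨k, hk, h⟩ := main (q - 1) d (by omega) le_rfl hd2 (by omega) hne'
  rw [hn] at h
  refine ⟨k, ?_, h⟩
  rw [hk]
  zify at hn
  linarith
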